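/- Let $g$ be a function on $(0,1]$ with $0<g(u)<1$ for all $u\in(0,1]$ that is piecewise Lipschitz, i.e. $(0,1]$ is a finite union of mutually disjoint intervals on each of which $g$ is Lipschitz. For each sample size $n\ge 1$ let $a_{n,1},\dots,a_{n,n}$ be independent $\{0,1\}$-valued random variables with $p_{n,t}:=P(a_{n,t}=1)=g(t/n)$ for $1\le t\le n$; all the variables $a_{n,t}$ live on one probability space, with no restriction on the dependence between samples of different sizes. Write $z_{n,t}=a_{n,t}-p_{n,t}$, fix an integer $m\ge 1$, and put, for $0\le h\le m$, $$\tilde\gamma_n(h)=\frac{1}{n-h}\sum_{t=1+h}^{n}z_{n,t}\,z_{n,t-h},\qquad \overline{A}_m=\left(\frac{\tilde\gamma_n(1)}{\tilde\gamma_n(0)},\dots,\frac{\tilde\gamma_n(m)}{\tilde\gamma_n(0)}\right)',$$ $$\hat\omega=\frac{n^{-1}\sum_{t=2}^{n}z_{n,t}^2\,z_{n,t-1}^2}{\left[n^{-1}\sum_{t=1}^{n}z_{n,t}^2\right]^2},\qquad \overline{\mathcal S}_m^{(a)}=n\,\hat\omega^{-1}\,\overline{A}_m'\overline{A}_m,\qquad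 \omega=\frac{\int_0^1 g^2(s)(1-g(s))^2\,ds}{\left(\int_0^1 g(s)(1-g(s))\,ds\right)^2}.$$ Then, as $n\to\infty$, $\sqrt n\,\overline{A}_m\stackrel{d}{\longrightarrow}N(0,\omega I_m)$ and $\overline{\mathcal S}_m^{(a)}\stackrel{d}{\longrightarrow}\chi^2_m$, where $I_m$ is the $m\times m$ identity matrix and $\chi^2_m$ is the chi-squared distribution with $m$ degrees of freedom; moreover $\hat\omega\to\omega$ almost surely. -/

import Mathlib

open MeasureTheory ProbabilityTheory Filter Topology

namespace TradeTest

/-- `g` is piecewise Lipschitz on `(0,1]`: there are finitely many mutually disjoint intervals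
with union `(0,1]` on each of which `g` is Lipschitz. -/
def PiecewiseLipschitz (g : ℝ → ℝ) : Prop :=
  ∃ (p : ℕ) (I : Fin p → Set ℝ),
    (∀ l, (I l).OrdConnected) ∧ Pairwise (fun k l => Disjoint (I k) (I l)) ∧
    (⋃ l, I l) = Set.Ioc (0 : ℝ) 1 ∧ ∀ l, ∃ K : NNReal, LipschitzOnWith K g (I l)

noncomputable section

variable {Ω : Type*} [MeasurableSpace Ω]

/-- The trade probability `P(a_t = 1)` at date `t` in the sample of size `n`. The data form a
triangular array: `a n t` is the `t`-th observation (`1 ≤ t ≤ n`) in the sample of size `n`. -/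
def tradeProb (μ : Measure Ω) (a : ℕ → ℕ → Ω → ℝ) (n t : ℕ) : ℝ :=
  μ.real {x | a n t x = 1}

/-- The centered variable `a_t - P(a_t = 1)`. -/
def centered (μ : Measure Ω) (a : ℕ → ℕ → Ω → ℝ) (n t : ℕ) (x : Ω) : ℝ :=
  a n t x - tradeProb μ a n t

/-- The full-sample statistic
`(n-h)⁻¹ ∑_{t=1+h}^n (a_t - P(a_t=1)) (a_{t-h} - P(a_{t-h}=1))`. -/
def gammaTilde (μ : Measure Ω) (a : ℕ → ℕ → Ω → ℝ) (n h : ℕ) (x : Ω) : ℝ :=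
  ((n : ℝ) - h)⁻¹ * ∑ t ∈ Finset.Icc (1 + h) n, centered μ a n t x * centered μ a n (t - h) x

/-- The vector of the ratios of lag `h = 1, …, m` to lag `0`. -/
def Abar (μ : Measure Ω) (a : ℕ → ℕ → Ω → ℝ) (m n : ℕ) (x : Ω) : EuclideanSpace ℝ (Fin m) :=
  WithLp.toLp 2 fun i => gammaTilde μ a n ((i : ℕ) + 1) x / gammaTilde μ a n 0 x

/-- The estimator of the asymptotic variance. -/
def omegaHat (μ : Measure Ω) (a : ℕ → ℕ → Ω → ℝ) (n : ℕ) (x : Ω) : ℝ :=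
  ((n : ℝ)⁻¹ * ∑ t ∈ Finset.Icc 2 n, centered μ a n t x ^ 2 * centered μ a n (t - 1) x ^ 2) /
    ((n : ℝ)⁻¹ * ∑ t ∈ Finset.Icc 1 n, centered μ a n t x ^ 2) ^ 2

/-- The heteroscedasticity-corrected portmanteau statistic `n ω̂⁻¹ A' A`. -/
def Sbar (μ : Measure Ω) (a : ℕ → ℕ → Ω → ℝ) (m n : ℕ) (x : Ω) : ℝ :=
  (n : ℝ) * (omegaHat μ a n x)⁻¹ * ∑ i, Abar μ a m n x i * Abar μ a m n x i

/-- The asymptotic variance. -/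
def omega (g : ℝ → ℝ) : ℝ :=
  (∫ s in (0 : ℝ)..1, g s ^ 2 * (1 - g s) ^ 2) / (∫ s in (0 : ℝ)..1, g s * (1 - g s)) ^ 2

/-- The chi-squared distribution with `m` degrees of freedom: the law of the sum of the squares
of `m` independent standard normal variables. -/
def chiSquared (m : ℕ) : Measure ℝ :=
  (Measure.pi fun _ : Fin m => gaussianReal 0 1).map fun y => ∑ i, y i ^ 2

instance isProbabilityMeasure_chiSquared (m : ℕ) : IsProbabilityMeasure (chiSquared m) :=
  Measure.isProbabilityMeasure_map
    (Measurable.aemeasurable (Finset.measurable_sum _ fun i _ => (measurable_pi_apply i).pow_const 2))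

end

end TradeTest

/-! Put `f = g (1 - g)`. The centered variables of one row are independent with mean zero, so their
lagged products, and all linear combinations of these, are bounded martingale differences for the
natural filtration of the row. Two tools are needed, both for arrays whose rows are otherwise
unrelated.

The strong law `ae_tendsto_average_of_isMartingaleDiff` rests on tail bounds that are geometric in
the row length, so Borel–Cantelli applies whatever the dependence between rows. The central limit
theorem `tendsto_integral_exp_of_isMartingaleDiff` is McLeish's argument: `∏ (1 + i y_k)` has mean
exactly one and is close to `exp(i ∑ y_k) exp(∑ y_k² / 2)`, so it suffices that the averaged squares
converge.

For a binary variable with mean `p`, `z² = p(1 - p) + (1 - 2p) z`. Squares thus split into a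
deterministic part and a martingale difference. The strong law removes the latter, and Riemann sums
of the almost everywhere continuous `f` give the limits `ν = ∫ f` and `κ = ∫ f²`, with `ω = κ / ν²`.
Products of distinct lags average to zero, hence the diagonal covariance. Cramér–Wold gives the
joint limit, and Slutsky's lemma inserts the random denominators. -/

namespace TradeTest

/-! ### Bounded martingale differences: exponential bounds and the strong law. -/

variable {Ω : Type*} [mΩ : MeasurableSpace Ω] {μ : Measure Ω}

/-- A uniformly bounded martingale difference sequence, with `d k` known at time `k + 1`. -/
structure IsMartingaleDiff (μ : Measure Ω) (ℱ : Filtration ℕ mΩ) (d : ℕ → Ω → ℝ) (C : ℝ) :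
    Prop where
  measurable : ∀ k, Measurable[ℱ (k + 1)] (d k)
  bound : ∀ k x, |d k x| ≤ C
  condExp : ∀ k, μ[d k | ℱ k] =ᵐ[μ] 0

/-- Pull `F` out of the conditional expectation and integrate. Vector values are allowed because `F`
is a real exponential in the strong law and a complex product in the central limit theorem. -/
lemma integral_smul_eq_zero_of_condExp [IsProbabilityMeasure μ] {E : Type*} [NormedAddCommGroup E] [NormedSpace ℝ E]
    [CompleteSpace E] {m : MeasurableSpace Ω} (hm : m ≤ mΩ) {d : Ω → ℝ} {F : Ω → E}
    (hd : Integrable d μ) (hF : StronglyMeasurable[m] F) (hdF : Integrable (d • F) μ)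
    (h0 : μ[d | m] =ᵐ[μ] 0) : ∫ x, d x • F x ∂μ = 0 := by
  have h := condExp_smul_of_aestronglyMeasurable_right (m := m) hd hdF hF.aestronglyMeasurable
  calc ∫ x, d x • F x ∂μ = ∫ x, (μ[d • F | m]) x ∂μ := (integral_condExp hm).symm
    _ = ∫ x, (0 : E) ∂μ := by
      refine integral_congr_ae ?_
      filter_upwards [h, h0] with x hx hx0
      simp [hx, hx0]
    _ = 0 := by simp

namespace IsMartingaleDiff

variable {ℱ : Filtration ℕ mΩ} {d : ℕ → Ω → ℝ} {C : ℝ}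

lemma measurable_of_le (h : IsMartingaleDiff μ ℱ d C) {k N : ℕ} (hk : k < N) :
    Measurable[ℱ N] (d k) :=
  (h.measurable k).mono (ℱ.mono hk) le_rfl

lemma measurable' (h : IsMartingaleDiff μ ℱ d C) (k : ℕ) : Measurable (d k) :=
  (h.measurable k).mono (ℱ.le _) le_rfl

lemma measurable_sum (h : IsMartingaleDiff μ ℱ d C) (N : ℕ) :
    Measurable[ℱ N] fun x => ∑ k ∈ Finset.range N, d k x :=
  Finset.measurable_sum _ fun _ hk => h.measurable_of_le (Finset.mem_range.1 hk)

lemma abs_sum_le (h : IsMartingaleDiff μ ℱ d C) (N : ℕ) (x : Ω) :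
    |∑ k ∈ Finset.range N, d k x| ≤ N * C := by
  refine (Finset.abs_sum_le_sum_abs _ _).trans ?_
  refine (Finset.sum_le_sum fun k _ => h.bound k x).trans ?_
  simp

lemma neg (h : IsMartingaleDiff μ ℱ d C) : IsMartingaleDiff μ ℱ (fun k x => -d k x) C where
  measurable k := (h.measurable k).neg
  bound k x := by simpa using h.bound k x
  condExp k := by
    have : (fun x => -d k x) = -d k := rfl
    rw [this]
    filter_upwards [condExp_neg (d k) (ℱ k) (μ := μ), h.condExp k] with x hx hx'
    simp [hx, hx']

lemma const_mul (h : IsMartingaleDiff μ ℱ d C) (r : ℝ) :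
    IsMartingaleDiff μ ℱ (fun k x => r * d k x) (|r| * C) where
  measurable k := (h.measurable k).const_mul r
  bound k x := by
    rw [abs_mul]; exact mul_le_mul_of_nonneg_left (h.bound k x) (abs_nonneg _)
  condExp k := by
    have : (fun x => r * d k x) = r • d k := rfl
    rw [this]
    filter_upwards [condExp_smul r (d k) (ℱ k) (μ := μ), h.condExp k] with x hx hx'
    simp [hx, hx']

variable [IsProbabilityMeasure μ]

lemma integrable (h : IsMartingaleDiff μ ℱ d C) (k : ℕ) : Integrable (d k) μ :=
  Integrable.of_bound (h.measurable' k).aestronglyMeasurable C (ae_of_all _ (h.bound k))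

lemma integrable_exp (h : IsMartingaleDiff μ ℱ d C) (r : ℝ) (N : ℕ) :
    Integrable (fun x => Real.exp (r * ∑ k ∈ Finset.range N, d k x)) μ := by
  refine Integrable.of_bound (C := Real.exp (|r| * (N * C))) ?_ (ae_of_all _ fun x => ?_)
  · have := (h.measurable_sum N).mono (ℱ.le _) le_rfl
    exact (this.const_mul r).exp.aestronglyMeasurable
  · rw [Real.norm_eq_abs, Real.abs_exp, Real.exp_le_exp]
    refine (le_abs_self _).trans ?_
    rw [abs_mul]
    exact mul_le_mul_of_nonneg_left (h.abs_sum_le N x) (abs_nonneg _)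

/-- Since `e^u ≤ 1 + u + u²` for `|u| ≤ 1`, and the linear term is orthogonal to the past, each step
costs at most a factor `1 + (rC)²`. -/
lemma integral_exp_le (h : IsMartingaleDiff μ ℱ d C) {r : ℝ} (hr : |r| * C ≤ 1) (N : ℕ) :
    ∫ x, Real.exp (r * ∑ k ∈ Finset.range N, d k x) ∂μ ≤ (1 + (r * C) ^ 2) ^ N := by
  induction N with
  | zero => simp
  | succ N ih =>
    set F : Ω → ℝ := fun x => Real.exp (r * ∑ k ∈ Finset.range N, d k x) with hF
    have hFi : Integrable F μ := h.integrable_exp r N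
    have hFm : StronglyMeasurable[ℱ N] F :=
      (((h.measurable_sum N).const_mul r).exp).stronglyMeasurable
    have hdF : Integrable (d N • F) μ :=
      hFi.bdd_mul (c := C) (h.measurable' N).aestronglyMeasurable (ae_of_all _ (h.bound N))
    have hdF : Integrable (fun x => d N x • F x) μ := hdF
    have h0 : ∫ x, d N x • F x ∂μ = 0 :=
      integral_smul_eq_zero_of_condExp (ℱ.le N) (h.integrable N) hFm hdF (h.condExp N)
    have key : ∀ x, Real.exp (r * ∑ k ∈ Finset.range (N + 1), d k x) ≤
        (1 + (r * C) ^ 2) * F x + r * (d N x • F x) := by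
      intro x
      have hb : |r * d N x| ≤ |r| * C := by
        rw [abs_mul]; exact mul_le_mul_of_nonneg_left (h.bound N x) (abs_nonneg _)
      have h1 := (abs_le.1 (Real.abs_exp_sub_one_sub_id_le (hb.trans hr))).2
      have h2 : (r * d N x) ^ 2 ≤ (r * C) ^ 2 := by
        rw [← sq_abs (r * d N x)]
        calc |r * d N x| ^ 2 ≤ (|r| * C) ^ 2 := pow_le_pow_left₀ (abs_nonneg _) hb 2
          _ = (r * C) ^ 2 := by rw [mul_pow, sq_abs, mul_pow]
      rw [Finset.sum_range_succ, mul_add, Real.exp_add, smul_eq_mul]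
      have hFp : 0 < F x := Real.exp_pos _
      have : Real.exp (r * d N x) ≤ (1 + (r * C) ^ 2) + r * d N x := by linarith
      calc _ ≤ F x * ((1 + (r * C) ^ 2) + r * d N x) :=
            mul_le_mul_of_nonneg_left this hFp.le
        _ = _ := by ring
    calc _ ≤ ∫ x, ((1 + (r * C) ^ 2) * F x + r * (d N x • F x)) ∂μ :=
          integral_mono (h.integrable_exp r (N + 1))
            ((hFi.const_mul _).add (hdF.const_mul r)) key
      _ = (1 + (r * C) ^ 2) * ∫ x, F x ∂μ := by
          rw [integral_add (hFi.const_mul _) (hdF.const_mul r), integral_const_mul,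
            integral_const_mul, h0, mul_zero, add_zero]
      _ ≤ _ := by
          have hnn : 0 ≤ 1 + (r * C) ^ 2 := by positivity
          rw [pow_succ' (1 + (r * C) ^ 2)]
          exact mul_le_mul_of_nonneg_left ih hnn

/-- Chernoff's bound at `r = δ / C`: the exponent is `-2δ²N` from Markov's inequality plus at most
`δ²N` from the moment generating function. -/
lemma measureReal_ge_le (h : IsMartingaleDiff μ ℱ d C) (hC : 0 < C) {δ : ℝ} (hδ0 : 0 ≤ δ)
    (hδ : δ ≤ 1) (N : ℕ) :
    μ.real {x | 2 * C * δ * N ≤ ∑ k ∈ Finset.range N, d k x} ≤ Real.exp (-δ ^ 2) ^ N := by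
  have hr : |δ / C| * C ≤ 1 := by
    rw [abs_of_nonneg (by positivity), div_mul_cancel₀ _ hC.ne']; exact hδ
  have h1 := measure_ge_le_exp_mul_mgf (X := fun x => ∑ k ∈ Finset.range N, d k x)
    (2 * C * δ * N) (t := δ / C) (by positivity) (h.integrable_exp _ N)
  have h2 := h.integral_exp_le hr N
  rw [div_mul_cancel₀ _ hC.ne'] at h2
  refine h1.trans ?_
  have h3 : (1 + δ ^ 2) ^ N ≤ Real.exp (δ ^ 2) ^ N :=
    pow_le_pow_left₀ (by positivity) (by linarith [Real.add_one_le_exp (δ ^ 2)]) N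
  calc _ ≤ Real.exp (-(δ / C) * (2 * C * δ * N)) * Real.exp (δ ^ 2) ^ N :=
        mul_le_mul_of_nonneg_left (h2.trans h3) (Real.exp_pos _).le
    _ = _ := by
        rw [← Real.exp_nat_mul, ← Real.exp_nat_mul, ← Real.exp_add]
        congr 1; field_simp; ring

end IsMartingaleDiff

variable [IsProbabilityMeasure μ]

/-- Strong law of large numbers for the rows of an array of bounded martingale differences. -/
theorem ae_tendsto_average_of_isMartingaleDiff {ℱ : ℕ → Filtration ℕ mΩ}
    {d : ℕ → ℕ → Ω → ℝ} {C : ℝ} (h : ∀ n, IsMartingaleDiff μ (ℱ n) (d n) C) :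
    ∀ᵐ x ∂μ, Tendsto (fun n : ℕ => (n : ℝ)⁻¹ * ∑ k ∈ Finset.range n, d n k x) atTop (𝓝 0) := by
  wlog hC : 0 < C generalizing C
  · exact this (C := |C| + 1) (fun n => ⟨(h n).measurable,
      fun k x => ((h n).bound k x).trans ((le_abs_self C).trans (by linarith)),
      (h n).condExp⟩) (by positivity)
  -- One-sided Borel–Cantelli, stated for a general array so that it also applies to the negated
  -- one. Thresholds `1 / (j + 1)` keep the exceptional sets countable in number.
  have upper : ∀ {e : ℕ → ℕ → Ω → ℝ}, (∀ n, IsMartingaleDiff μ (ℱ n) (e n) C) → ∀ j : ℕ,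
      ∀ᵐ x ∂μ, ∀ᶠ n : ℕ in atTop,
        ∑ k ∈ Finset.range n, e n k x < 2 * C * (1 / ((j : ℝ) + 1)) * n := by
    intro e he j
    set δ : ℝ := 1 / ((j : ℝ) + 1) with hδ
    have hδ0 : 0 < δ := by positivity
    have hδ1 : δ ≤ 1 := by
      rw [hδ, div_le_one (by positivity)]; linarith [(Nat.cast_nonneg j : (0 : ℝ) ≤ j)]
    have hsum : ∑' n : ℕ, μ {x | 2 * C * δ * n ≤ ∑ k ∈ Finset.range n, e n k x} ≠ ⊤ := by
      have hs : Summable fun n : ℕ => Real.exp (-δ ^ 2) ^ n :=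
        summable_geometric_of_lt_one (Real.exp_pos _).le
          (by rw [Real.exp_lt_one_iff]; nlinarith)
      refine ne_top_of_le_ne_top hs.tsum_ofReal_ne_top (ENNReal.tsum_le_tsum fun n => ?_)
      rw [← ofReal_measureReal]
      exact ENNReal.ofReal_le_ofReal ((he n).measureReal_ge_le hC hδ0.le hδ1 n)
    filter_upwards [ae_eventually_notMem hsum] with x hx
    filter_upwards [hx] with n hn
    simpa using hn
  have h1 := ae_all_iff.2 (upper h)
  have h2 := ae_all_iff.2 (upper fun n => (h n).neg)
  filter_upwards [h1, h2] with x hx1 hx2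
  rw [Metric.tendsto_atTop']
  intro ε hε
  obtain ⟨j, hj⟩ := exists_nat_one_div_lt (show 0 < ε / (2 * C) by positivity)
  obtain ⟨n₀, hn₀⟩ := eventually_atTop.1 ((hx1 j).and ((hx2 j).and (eventually_gt_atTop 0)))
  refine ⟨n₀, fun n hn => ?_⟩
  obtain ⟨ha, hb, hn0⟩ := hn₀ n hn.le
  have hnp : (0 : ℝ) < n := by exact_mod_cast hn0
  rw [Finset.sum_neg_distrib] at hb
  rw [Real.dist_eq, sub_zero, abs_mul, abs_of_pos (inv_pos.2 hnp), inv_mul_lt_iff₀ hnp, abs_lt]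
  have : 2 * C * (1 / ((j : ℝ) + 1)) * n < n * ε := by
    rw [lt_div_iff₀ (by positivity)] at hj
    rw [mul_comm (n : ℝ)]
    exact mul_lt_mul_of_pos_right (by linarith) hnp
  constructor <;> linarith

/-! ### Central limit theorem by McLeish's product. -/

section CentralLimit

open Complex

/-- Replace the factors one at a time; the other factors are bounded by `M`. -/
lemma norm_prod_range_sub_prod_range_le {a b : ℕ → ℂ} {M η : ℝ} (hM : 1 ≤ M)
    (ha : ∀ k, ‖a k‖ ≤ M) (hb : ∀ k, ‖b k‖ ≤ M) (hab : ∀ k, ‖a k - b k‖ ≤ η) (n : ℕ) :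
    ‖∏ k ∈ Finset.range n, a k - ∏ k ∈ Finset.range n, b k‖ ≤ n * η * M ^ n := by
  have hη : 0 ≤ η := (norm_nonneg _).trans (hab 0)
  have hM0 : 0 ≤ M := zero_le_one.trans hM
  induction n with
  | zero => simp
  | succ n ih =>
    rw [Finset.prod_range_succ, Finset.prod_range_succ]
    have hA : ‖∏ k ∈ Finset.range n, a k‖ ≤ M ^ n := by
      rw [norm_prod]
      calc _ ≤ ∏ k ∈ Finset.range n, M :=
            Finset.prod_le_prod (fun _ _ => norm_nonneg _) fun k _ => ha k
        _ = M ^ n := by simp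
    have e : (∏ k ∈ Finset.range n, a k) * a n - (∏ k ∈ Finset.range n, b k) * b n =
        (∏ k ∈ Finset.range n, a k) * (a n - b n) +
          (∏ k ∈ Finset.range n, a k - ∏ k ∈ Finset.range n, b k) * b n := by ring
    rw [e]
    refine (norm_add_le _ _).trans ?_
    rw [norm_mul, norm_mul]
    have h1 : ‖∏ k ∈ Finset.range n, a k‖ * ‖a n - b n‖ ≤ M ^ n * η :=
      mul_le_mul hA (hab n) (norm_nonneg _) (by positivity)
    have h2 : ‖∏ k ∈ Finset.range n, a k - ∏ k ∈ Finset.range n, b k‖ * ‖b n‖ ≤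
        n * η * M ^ n * M := mul_le_mul ih (hb n) (norm_nonneg _) (by positivity)
    have h3 : M ^ n * η ≤ M ^ (n + 1) * η :=
      mul_le_mul_of_nonneg_right (pow_le_pow_right₀ hM (Nat.le_succ n)) hη
    push_cast
    calc _ ≤ M ^ (n + 1) * η + n * η * M ^ n * M := by linarith
      _ = _ := by ring

/-- For `w = ix + x²/2` the quadratic terms of `1 + w + w²/2` cancel, so the error against `1 + ix`
is cubic. -/
lemma norm_exp_mul_I_add_sq_sub_le {x : ℝ} (hx : |x| ≤ 1) :
    ‖cexp (x * I + x ^ 2 / 2) - (1 + x * I)‖ ≤ (8 * Real.exp 2 + 1) * |x| ^ 3 := by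
  set w : ℂ := x * I + x ^ 2 / 2 with hw
  have hx0 := abs_nonneg x
  have hwn : ‖w‖ ≤ 2 * |x| := by
    refine (norm_add_le _ _).trans ?_
    simp only [norm_mul, norm_real, norm_I, mul_one, norm_div, norm_pow, Real.norm_eq_abs]
    have : |x| ^ 2 ≤ |x| := pow_le_of_le_one hx0 hx two_ne_zero
    norm_num at this ⊢
    linarith
  have h1 := norm_exp_sub_sum_le_norm_mul_exp w 3
  have hsum : ∑ m ∈ Finset.range 3, w ^ m / (m.factorial : ℂ) = 1 + w + w ^ 2 / 2 := by
    simp [Finset.sum_range_succ]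
  rw [hsum] at h1
  have hpoly : 1 + w + w ^ 2 / 2 - (1 + x * I) = (x : ℂ) ^ 3 * I / 2 + (x : ℂ) ^ 4 / 8 := by
    rw [hw]; ring_nf; simp only [I_sq]; ring
  have h2 : ‖1 + w + w ^ 2 / 2 - (1 + x * I)‖ ≤ |x| ^ 3 := by
    rw [hpoly]
    refine (norm_add_le _ _).trans ?_
    simp only [norm_mul, norm_real, norm_I, mul_one, norm_div, norm_pow, Real.norm_eq_abs]
    norm_num
    have : |x| ^ 4 ≤ |x| ^ 3 := pow_le_pow_of_le_one hx0 hx (by norm_num)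
    nlinarith [pow_nonneg hx0 3]
  have h3 : ‖w‖ ^ 3 * Real.exp ‖w‖ ≤ (2 * |x|) ^ 3 * Real.exp 2 :=
    mul_le_mul (pow_le_pow_left₀ (norm_nonneg _) hwn 3)
      (Real.exp_le_exp.2 (by linarith)) (Real.exp_pos _).le (by positivity)
  calc _ = ‖(cexp w - (1 + w + w ^ 2 / 2)) + (1 + w + w ^ 2 / 2 - (1 + x * I))‖ := by ring_nf
    _ ≤ _ := norm_add_le _ _
    _ ≤ (2 * |x|) ^ 3 * Real.exp 2 + |x| ^ 3 := add_le_add (h1.trans h3) h2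
    _ = _ := by ring

lemma norm_one_add_mul_I_le (x : ℝ) : ‖1 + (x : ℂ) * I‖ ≤ Real.exp (x ^ 2 / 2) := by
  have h1 : ‖1 + (x : ℂ) * I‖ ^ 2 = 1 + x ^ 2 := by
    rw [← normSq_eq_norm_sq, ← ofReal_one, normSq_add_mul_I]; ring
  refine le_of_sq_le_sq ?_ (Real.exp_pos _).le
  rw [h1, ← Real.exp_nat_mul]
  have := Real.add_one_le_exp (x ^ 2)
  have e : ((2 : ℕ) : ℝ) * (x ^ 2 / 2) = x ^ 2 := by push_cast; ring
  rw [e]; linarith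

lemma norm_exp_mul_I_add_sq_le (x : ℝ) :
    ‖cexp (x * I + x ^ 2 / 2)‖ ≤ Real.exp (x ^ 2 / 2) := by
  have : ((x : ℂ) * I + x ^ 2 / 2) = ((x ^ 2 / 2 : ℝ) : ℂ) + x * I := by push_cast; ring
  rw [this, norm_exp, add_re, re_ofReal_mul, ofReal_re, I_re, mul_zero, add_zero]

/-- The product is a martingale: a new factor adds `i d_N` times a function of the past, which
integrates to zero. -/
lemma IsMartingaleDiff.integral_prod_one_add {ℱ : Filtration ℕ mΩ} {d : ℕ → Ω → ℝ} {C : ℝ}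
    (h : IsMartingaleDiff μ ℱ d C) (N : ℕ) :
    ∫ x, ∏ k ∈ Finset.range N, (1 + (d k x : ℂ) * I) ∂μ = 1 := by
  induction N with
  | zero => simp
  | succ N ih =>
    set F : Ω → ℂ := fun x => ∏ k ∈ Finset.range N, (1 + (d k x : ℂ) * I) with hF
    have hFm : StronglyMeasurable[ℱ N] F := by
      refine Measurable.stronglyMeasurable ?_
      refine Finset.measurable_prod _ fun k hk => ?_
      have := h.measurable_of_le (Finset.mem_range.1 hk)
      exact ((measurable_ofReal.comp this).mul_const I).const_add 1
    have hFb : ∀ x, ‖F x‖ ≤ Real.exp (C ^ 2 / 2) ^ N := by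
      intro x
      rw [hF, norm_prod]
      calc _ ≤ ∏ k ∈ Finset.range N, Real.exp (C ^ 2 / 2) := by
            refine Finset.prod_le_prod (fun _ _ => norm_nonneg _) fun k _ => ?_
            refine (norm_one_add_mul_I_le _).trans (Real.exp_le_exp.2 ?_)
            have := pow_le_pow_left₀ (abs_nonneg _) (h.bound k x) 2
            rw [sq_abs] at this
            linarith
        _ = _ := by simp
    have hFi : Integrable F μ := Integrable.of_bound
      (hFm.mono (ℱ.le N)).aestronglyMeasurable _ (ae_of_all _ hFb)
    have hdF : Integrable (d N • F) μ :=
      hFi.bdd_smul C (h.measurable' N).aestronglyMeasurable (ae_of_all _ (h.bound N))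
    have hdF : Integrable (fun x => d N x • F x) μ := hdF
    have h0 : ∫ x, d N x • F x ∂μ = 0 :=
      integral_smul_eq_zero_of_condExp (ℱ.le N) (h.integrable N) hFm hdF (h.condExp N)
    calc _ = ∫ x, (F x + I * (d N x • F x)) ∂μ := by
          refine integral_congr_ae (ae_of_all _ fun x => ?_)
          simp only [Finset.prod_range_succ, real_smul]
          ring
      _ = 1 := by
          rw [integral_add hFi (hdF.const_mul I), integral_const_mul, h0, mul_zero, add_zero, ih]

/-- Central limit theorem for the rows of an array of bounded martingale differences, in terms of
characteristic functions. -/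
theorem tendsto_integral_exp_of_isMartingaleDiff {ℱ : ℕ → Filtration ℕ mΩ}
    {d : ℕ → ℕ → Ω → ℝ} {C : ℝ} (h : ∀ n, IsMartingaleDiff μ (ℱ n) (d n) C) {q : ℝ}
    (hq : ∀ᵐ x ∂μ, Tendsto (fun n : ℕ => (n : ℝ)⁻¹ * ∑ k ∈ Finset.range n, d n k x ^ 2)
      atTop (𝓝 q)) :
    Tendsto (fun n : ℕ => ∫ x, cexp (((√(n : ℝ))⁻¹ * ∑ k ∈ Finset.range n, d n k x : ℝ) * I) ∂μ)
      atTop (𝓝 (cexp (-(q / 2 : ℝ)))) := by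
  have hC : 0 ≤ C := by
    obtain ⟨x⟩ : Nonempty Ω := nonempty_of_isProbabilityMeasure μ
    exact (abs_nonneg _).trans ((h 0).bound 0 x)
  set y : ℕ → ℕ → Ω → ℝ := fun n k x => (√(n : ℝ))⁻¹ * d n k x with hy
  have hmd : ∀ n, IsMartingaleDiff μ (ℱ n) (y n) (|(√(n : ℝ))⁻¹| * C) :=
    fun n => (h n).const_mul _
  set T : ℕ → Ω → ℂ := fun n x => ∏ k ∈ Finset.range n, (1 + (y n k x : ℂ) * I) with hT
  set S : ℕ → Ω → ℝ := fun n x => (√(n : ℝ))⁻¹ * ∑ k ∈ Finset.range n, d n k x with hS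
  set Q : ℕ → Ω → ℝ := fun n x => (n : ℝ)⁻¹ * ∑ k ∈ Finset.range n, d n k x ^ 2 with hQ
  set δ : ℕ → ℝ := fun n => (√(n : ℝ))⁻¹ * C with hδ
  have hyb : ∀ n k x, |y n k x| ≤ δ n := by
    intro n k x
    have := (hmd n).bound k x
    rwa [abs_of_nonneg (a := (√(n : ℝ))⁻¹) (by positivity)] at this
  set M : ℕ → ℝ := fun n => Real.exp (δ n ^ 2 / 2) with hM
  have hysq : ∀ n k x, Real.exp (y n k x ^ 2 / 2) ≤ M n := by
    intro n k x
    refine Real.exp_le_exp.2 ?_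
    have := pow_le_pow_left₀ (abs_nonneg _) (hyb n k x) 2
    rw [sq_abs] at this
    linarith
  have hM1 : ∀ n, 1 ≤ M n := fun n => Real.one_le_exp (by positivity)
  -- For `n > 0`, `n δ_n² = C²`; this deterministic bound on the products later serves as the
  -- dominating constant.
  have hMn : ∀ n, M n ^ n ≤ Real.exp (C ^ 2 / 2) := by
    intro n
    rw [hM, ← Real.exp_nat_mul, Real.exp_le_exp]
    rcases Nat.eq_zero_or_pos n with rfl | hn
    · simp; positivity
    · have hn' : (0 : ℝ) < n := by exact_mod_cast hn
      rw [hδ]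
      simp only [mul_pow, inv_pow, Real.sq_sqrt hn'.le]
      apply le_of_eq; field_simp
  have hTb : ∀ n x, ‖T n x‖ ≤ Real.exp (C ^ 2 / 2) := by
    intro n x
    refine le_trans ?_ (hMn n)
    rw [hT, norm_prod]
    calc _ ≤ ∏ k ∈ Finset.range n, M n := Finset.prod_le_prod (fun _ _ => norm_nonneg _)
          fun k _ => (norm_one_add_mul_I_le _).trans (hysq n k x)
      _ = _ := by simp
  have hTm : ∀ n, Measurable (T n) := fun n => Finset.measurable_prod _ fun k _ =>
    ((measurable_ofReal.comp ((hmd n).measurable' k)).mul_const I).const_add 1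
  have hSm : ∀ n, Measurable (S n) := fun n =>
    (Finset.measurable_sum _ fun k _ => (h n).measurable' k).const_mul _
  have hEm : ∀ n, Measurable fun x => cexp ((S n x : ℝ) * I) := fun n =>
    ((measurable_ofReal.comp (hSm n)).mul_const I).cexp
  have hTi : ∀ n, Integrable (T n) μ := fun n =>
    Integrable.of_bound (hTm n).aestronglyMeasurable _ (ae_of_all _ (hTb n))
  have hEi : ∀ n, Integrable (fun x => cexp ((S n x : ℝ) * I)) μ := fun n =>
    Integrable.of_bound (hEm n).aestronglyMeasurable 1
      (ae_of_all _ fun x => (norm_exp_ofReal_mul_I _).le)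
  have hprod : ∀ n x, ∏ k ∈ Finset.range n, cexp (y n k x * I + y n k x ^ 2 / 2) =
      cexp (S n x * I) * cexp ((Q n x / 2 : ℝ)) := by
    intro n x
    rw [← exp_sum, ← exp_add, Finset.sum_add_distrib, ← Finset.sum_mul, ← Finset.sum_div]
    congr 2
    · simp only [hS, hy]; push_cast; rw [Finset.mul_sum]
    · simp only [hQ, hy]; push_cast
      rw [Finset.mul_sum]
      congr 1
      refine Finset.sum_congr rfl fun k _ => ?_
      rw [mul_pow, inv_pow, ← ofReal_pow, Real.sq_sqrt (Nat.cast_nonneg n)]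
      simp
  have hδ0 : Tendsto δ atTop (𝓝 0) := by
    have : Tendsto (fun n : ℕ => (√(n : ℝ))⁻¹) atTop (𝓝 0) :=
      tendsto_inv_atTop_zero.comp (Real.tendsto_sqrt_atTop.comp tendsto_natCast_atTop_atTop)
    simpa using this.mul_const C
  set B : ℝ := 8 * Real.exp 2 + 1 with hB
  -- There are `n` factors, each with error `B δ_n³`; as `n δ_n² = C²`, the total is of order `δ_n`,
  -- uniformly in `x`.
  have hdiff : ∀ᶠ n in atTop, ∀ x, ‖cexp (S n x * I) * cexp ((Q n x / 2 : ℝ)) - T n x‖ ≤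
      B * C ^ 2 * Real.exp (C ^ 2 / 2) * δ n := by
    filter_upwards [hδ0.eventually (Iio_mem_nhds one_pos), eventually_gt_atTop 0] with n hn hn0 x
    have hn' : (0 : ℝ) < n := by exact_mod_cast hn0
    have hδn : 0 ≤ δ n := by positivity
    rw [← hprod]
    refine (norm_prod_range_sub_prod_range_le (M := M n) (η := B * δ n ^ 3) (hM1 n)
      (fun k => (norm_exp_mul_I_add_sq_le _).trans (hysq n k x))
      (fun k => (norm_one_add_mul_I_le _).trans (hysq n k x)) (fun k => ?_) n).trans ?_
    · refine (norm_exp_mul_I_add_sq_sub_le ((hyb n k x).trans hn.le)).trans ?_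
      exact mul_le_mul_of_nonneg_left (pow_le_pow_left₀ (abs_nonneg _) (hyb n k x) 3)
        (by positivity)
    · have e : (n : ℝ) * δ n ^ 2 = C ^ 2 := by
        simp only [hδ, mul_pow, inv_pow, Real.sq_sqrt hn'.le]
        field_simp
      calc (n : ℝ) * (B * δ n ^ 3) * M n ^ n = B * (n * δ n ^ 2) * δ n * M n ^ n := by ring
        _ ≤ B * (n * δ n ^ 2) * δ n * Real.exp (C ^ 2 / 2) :=
          mul_le_mul_of_nonneg_left (hMn n) (by positivity)
        _ = _ := by rw [e]; ring
  set c : ℂ := cexp (-(q / 2 : ℝ)) with hc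
  -- As `T n` has mean one, this integral is the characteristic function minus `c`. The integrand is
  -- bounded and tends to zero almost surely, because `exp(iS) ≈ exp(-Q/2) T` and `Q → q`.
  have hlim : Tendsto (fun n => ∫ x, (cexp ((S n x : ℝ) * I) - c * T n x) ∂μ) atTop (𝓝 0) := by
    have := tendsto_integral_of_dominated_convergence (μ := μ)
      (F := fun n x => cexp ((S n x : ℝ) * I) - c * T n x) (f := fun _ => (0 : ℂ))
      (fun _ => 1 + ‖c‖ * Real.exp (C ^ 2 / 2))
      (fun n => ((hEm n).sub ((hTm n).const_mul c)).aestronglyMeasurable)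
      (integrable_const _) (fun n => ae_of_all _ fun x => ?_) ?_
    · simpa using this
    · refine (norm_sub_le _ _).trans ?_
      rw [norm_exp_ofReal_mul_I, norm_mul]
      exact add_le_add le_rfl (mul_le_mul_of_nonneg_left (hTb n x) (norm_nonneg _))
    · filter_upwards [hq] with x hx
      have hcq : Tendsto (fun n => ‖cexp (-(Q n x / 2 : ℝ)) - c‖) atTop (𝓝 0) := by
        rw [← tendsto_iff_norm_sub_tendsto_zero]
        have hcont : Continuous fun r : ℝ => cexp (-(r / 2 : ℝ)) := by fun_prop
        exact (hcont.tendsto q).comp hx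
      have hbd : Tendsto (fun n => B * C ^ 2 * Real.exp (C ^ 2 / 2) * δ n +
          ‖cexp (-(Q n x / 2 : ℝ)) - c‖ * Real.exp (C ^ 2 / 2)) atTop (𝓝 0) := by
        simpa using (hδ0.const_mul (B * C ^ 2 * Real.exp (C ^ 2 / 2))).add
          (hcq.mul_const (Real.exp (C ^ 2 / 2)))
      refine squeeze_zero_norm' ?_ hbd
      filter_upwards [hdiff] with n hn
      have e : cexp ((S n x : ℝ) * I) - c * T n x =
          cexp (-(Q n x / 2 : ℝ)) * (cexp (S n x * I) * cexp ((Q n x / 2 : ℝ)) - T n x) +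
            (cexp (-(Q n x / 2 : ℝ)) - c) * T n x := by
        have : cexp (-(Q n x / 2 : ℝ)) * cexp ((Q n x / 2 : ℝ)) = 1 := by
          rw [← exp_add]; simp
        linear_combination (-cexp ((S n x : ℝ) * I)) * this
      rw [e]
      refine (norm_add_le _ _).trans ?_
      rw [norm_mul, norm_mul]
      refine add_le_add ?_ (mul_le_mul_of_nonneg_left (hTb n x) (norm_nonneg _))
      have hle : ‖cexp (-(Q n x / 2 : ℝ))‖ ≤ 1 := by
        rw [norm_exp, ← ofReal_neg, ofReal_re, Real.exp_le_one_iff]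
        have : 0 ≤ Q n x := by simp only [hQ]; positivity
        linarith
      calc _ ≤ 1 * (B * C ^ 2 * Real.exp (C ^ 2 / 2) * δ n) :=
            mul_le_mul hle (hn x) (norm_nonneg _) zero_le_one
        _ = _ := one_mul _
  have hsplit : ∀ n, ∫ x, (cexp ((S n x : ℝ) * I) - c * T n x) ∂μ =
      (∫ x, cexp ((S n x : ℝ) * I) ∂μ) - c := by
    intro n
    rw [integral_sub (hEi n) ((hTi n).const_mul c), integral_const_mul]
    simp only [hT]
    rw [(hmd n).integral_prod_one_add n, mul_one]
  simp_rw [hsplit] at hlim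
  have := hlim.add_const c
  simp only [sub_add_cancel, zero_add] at this
  exact this

end CentralLimit

end TradeTest

/-! ### Riemann sums of almost everywhere continuous functions. -/

namespace TradeTest

section Riemann

lemma natCeil_mul_eq {n k : ℕ} (hn : 0 < n) {s : ℝ}
    (hs : s ∈ Set.Ioc ((k : ℝ) / n) (((k + 1 : ℕ) : ℝ) / n)) : ⌈(n : ℝ) * s⌉₊ = k + 1 := by
  have hn' : (0 : ℝ) < n := by exact_mod_cast hn
  rw [Nat.ceil_eq_iff (Nat.succ_ne_zero k)]
  constructor
  · have := (div_lt_iff₀' hn').1 hs.1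
    simpa using this
  · exact (le_div_iff₀' hn').1 hs.2

lemma integral_comp_natCeil_mul (u : ℕ → ℝ) (n : ℕ) (hn : 0 < n) :
    ∫ s in (0 : ℝ)..1, u ⌈(n : ℝ) * s⌉₊ = (n : ℝ)⁻¹ * ∑ k ∈ Finset.range n, u (k + 1) := by
  have hn' : (0 : ℝ) < n := by exact_mod_cast hn
  have hle : ∀ k : ℕ, (k : ℝ) / n ≤ ((k + 1 : ℕ) : ℝ) / n := fun k => by
    gcongr; simp
  have heq : ∀ k : ℕ, ∀ s ∈ Set.uIoc ((k : ℝ) / n) (((k + 1 : ℕ) : ℝ) / n),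
      u (k + 1) = u ⌈(n : ℝ) * s⌉₊ := by
    intro k s hs
    rw [Set.uIoc_of_le (hle k)] at hs
    rw [natCeil_mul_eq hn hs]
  have hint : ∀ k < n, IntervalIntegrable (fun s : ℝ => u ⌈(n : ℝ) * s⌉₊) volume
      ((k : ℝ) / n) (((k + 1 : ℕ) : ℝ) / n) := fun k _ =>
    (intervalIntegrable_const (c := u (k + 1))).congr (heq k)
  have hsum := intervalIntegral.sum_integral_adjacent_intervals
    (a := fun k : ℕ => (k : ℝ) / n) hint
  simp only [Nat.cast_zero, zero_div, div_self hn'.ne'] at hsum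
  rw [← hsum, Finset.mul_sum]
  refine Finset.sum_congr rfl fun k _ => ?_
  rw [← intervalIntegral.integral_congr_ae (ae_of_all _ (heq k)),
    intervalIntegral.integral_const, smul_eq_mul]
  push_cast
  field_simp
  ring

/-- The average is the integral over `(0,1]` of the step function `s ↦ u n ⌈n s⌉₊`, so dominated
convergence applies and null sets of bad points are harmless. -/
lemma tendsto_average_of_tendsto_natCeil {u : ℕ → ℕ → ℝ} {F : ℝ → ℝ} {B : ℝ}
    (hB : ∀ n k, |u n k| ≤ B)
    (hF : ∀ᵐ s ∂(volume.restrict (Set.Ioc (0 : ℝ) 1)),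
      Tendsto (fun n : ℕ => u n ⌈(n : ℝ) * s⌉₊) atTop (𝓝 (F s))) :
    Tendsto (fun n : ℕ => (n : ℝ)⁻¹ * ∑ k ∈ Finset.range n, u n (k + 1)) atTop
      (𝓝 (∫ s in (0 : ℝ)..1, F s)) := by
  have h := tendsto_integral_of_dominated_convergence
    (μ := volume.restrict (Set.Ioc (0 : ℝ) 1))
    (F := fun (n : ℕ) (s : ℝ) => u n ⌈(n : ℝ) * s⌉₊) (f := F) (fun _ => B)
    (fun n => ((measurable_from_nat (f := u n)).comp
      (Nat.measurable_ceil.comp (measurable_const_mul (n : ℝ)))).aestronglyMeasurable)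
    (integrable_const _) (fun n => ae_of_all _ fun s => hB n _) hF
  rw [intervalIntegral.integral_of_le zero_le_one]
  refine h.congr' ?_
  filter_upwards [eventually_gt_atTop 0] with n hn
  rw [← intervalIntegral.integral_of_le zero_le_one, integral_comp_natCeil_mul (u n) n hn]

/-- An interval is convex, so its frontier is null; at interior points the Lipschitz bound gives
continuity. -/
lemma PiecewiseLipschitz.ae_continuousAt {g : ℝ → ℝ} (hg : PiecewiseLipschitz g) :
    ∀ᵐ s ∂(volume.restrict (Set.Ioc (0 : ℝ) 1)), ContinuousAt g s := by
  obtain ⟨p, I, hI, -, hU, hL⟩ := hg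
  have hfr : ∀ᵐ s ∂(volume.restrict (Set.Ioc (0 : ℝ) 1)), ∀ l, s ∉ frontier (I l) := by
    refine ae_all_iff.2 fun l => ae_restrict_of_ae ?_
    exact measure_eq_zero_iff_ae_notMem.1 ((hI l).convex.addHaar_frontier volume)
  filter_upwards [hfr, ae_restrict_mem measurableSet_Ioc] with s hs hs1
  rw [← hU] at hs1
  obtain ⟨l, hl⟩ := Set.mem_iUnion.1 hs1
  obtain ⟨K, hK⟩ := hL l
  have hint : s ∈ interior (I l) := by
    by_contra hn
    exact hs l ⟨subset_closure hl, hn⟩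
  exact hK.continuousOn.continuousAt (mem_interior_iff_mem_nhds.1 hint)

lemma tendsto_natCeil_mul_sub_div {s : ℝ} (hs : 0 ≤ s) (h : ℕ) :
    Tendsto (fun n : ℕ => ((⌈(n : ℝ) * s⌉₊ - h : ℕ) : ℝ) / n) atTop (𝓝 s) := by
  have h1 : Tendsto (fun n : ℕ => (⌈(n : ℝ) * s⌉₊ : ℝ) / n) atTop (𝓝 s) := by
    have := (tendsto_nat_ceil_mul_div_atTop hs).comp tendsto_natCast_atTop_atTop
    refine this.congr fun n => ?_
    simp [mul_comm]
  have h2 : Tendsto (fun n : ℕ => (⌈(n : ℝ) * s⌉₊ : ℝ) / n - h / n) atTop (𝓝 s) := by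
    simpa using h1.sub (tendsto_const_div_atTop_nhds_zero_nat (h : ℝ))
  refine tendsto_of_tendsto_of_tendsto_of_le_of_le h2 h1 (fun n => ?_) fun n => ?_
  · change _ / _ - _ / _ ≤ _
    rw [← sub_div]
    gcongr
    rw [sub_le_iff_le_add]
    rw [← Nat.cast_add, Nat.cast_le]
    exact le_tsub_add
  · change _ / _ ≤ _ / _
    gcongr
    exact Nat.sub_le _ _

end Riemann

end TradeTest

/-! ### Strong laws for lagged products of centered binary arrays. -/

namespace TradeTest

variable {Ω : Type*} [mΩ : MeasurableSpace Ω] {μ : Measure Ω}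

/-- The rows of `Z` are bounded martingale differences starting at `0`, whose squares are affine
functions of the variables themselves, as is the case for centered `{0,1}`-valued variables. -/
structure IsCenteredBinaryArray (μ : Measure Ω) (ℱ : ℕ → Filtration ℕ mΩ) (Z : ℕ → ℕ → Ω → ℝ)
    (v q : ℕ → ℕ → ℝ) : Prop where
  measurable : ∀ n t, Measurable[ℱ n t] (Z n t)
  zero : ∀ n x, Z n 0 x = 0
  bound : ∀ n t x, |Z n t x| ≤ 1
  condExp : ∀ n t, μ[Z n (t + 1) | ℱ n t] =ᵐ[μ] 0
  sq : ∀ n t x, Z n t x ^ 2 = v n t + q n t * Z n t x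
  abs_v_le : ∀ n t, |v n t| ≤ 1
  abs_q_le : ∀ n t, |q n t| ≤ 1

/-- The filtration delayed by `h`. -/
def delay (ℱ : Filtration ℕ mΩ) (h : ℕ) : Filtration ℕ mΩ where
  seq k := ℱ (k - h)
  mono' _ _ hij := ℱ.mono (Nat.sub_le_sub_right hij h)
  le' k := ℱ.le (k - h)

namespace IsCenteredBinaryArray

variable {ℱ : ℕ → Filtration ℕ mΩ} {Z : ℕ → ℕ → Ω → ℝ} {v q : ℕ → ℕ → ℝ}

lemma measurable_of_le (hZ : IsCenteredBinaryArray μ ℱ Z v q) (n : ℕ) {t N : ℕ} (ht : t ≤ N) :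
    Measurable[ℱ n N] (Z n t) :=
  (hZ.measurable n t).mono ((ℱ n).mono ht) le_rfl

lemma measurable' (hZ : IsCenteredBinaryArray μ ℱ Z v q) (n t : ℕ) : Measurable (Z n t) :=
  (hZ.measurable n t).mono ((ℱ n).le _) le_rfl

variable [IsProbabilityMeasure μ]

/-- The weight is known just before `Z n (k + 1 - h)` is revealed. Delaying the filtration by `h`
lets the lagged variable play the part of the newest one. -/
lemma isMartingaleDiff_mul (hZ : IsCenteredBinaryArray μ ℱ Z v q) (h n : ℕ) {W : ℕ → Ω → ℝ}
    {C : ℝ} (hW : ∀ k, Measurable[ℱ n (k - h)] (W k)) (hC : ∀ k x, |W k x| ≤ C) :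
    IsMartingaleDiff μ (delay (ℱ n) h) (fun k x => W k x * Z n (k + 1 - h) x) C where
  measurable k :=
    Measurable.mul ((hW k).mono ((ℱ n).mono (Nat.sub_le_sub_right (Nat.le_succ k) h)) le_rfl)
      (hZ.measurable n (k + 1 - h))
  bound k x := by
    rw [abs_mul]
    calc _ ≤ C * 1 := mul_le_mul (hC k x) (hZ.bound n _ x) (abs_nonneg _)
          ((abs_nonneg _).trans (hC k x))
      _ = C := mul_one C
  condExp k := by
    change μ[fun x => W k x * Z n (k + 1 - h) x | ℱ n (k - h)] =ᵐ[μ] 0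
    by_cases hk : h ≤ k
    · rw [Nat.succ_sub hk]
      have hZi : Integrable (Z n (k - h + 1)) μ := Integrable.of_bound
        (hZ.measurable' n _).aestronglyMeasurable 1 (ae_of_all _ (hZ.bound n _))
      have hWZ : Integrable (W k * Z n (k - h + 1)) μ :=
        hZi.bdd_mul (c := C) ((hW k).mono ((ℱ n).le _) le_rfl).aestronglyMeasurable
          (ae_of_all _ (hC k))
      have := condExp_mul_of_stronglyMeasurable_left (hW k).stronglyMeasurable hWZ hZi
      filter_upwards [this, hZ.condExp n (k - h)] with x hx hx0
      change (μ[W k * Z n (k - h + 1) | ℱ n (k - h)]) x = _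
      rw [hx, Pi.mul_apply, hx0]
      simp
    -- Truncated subtraction sends dates before the sample to `0`, where `Z` vanishes.
    · have h0 : k + 1 - h = 0 := by omega
      simp_rw [h0, hZ.zero, mul_zero]
      have : (fun _ : Ω => (0 : ℝ)) = 0 := rfl
      rw [this, condExp_zero]

lemma ae_tendsto_average_mul (hZ : IsCenteredBinaryArray μ ℱ Z v q) (h : ℕ)
    {W : ℕ → ℕ → Ω → ℝ} {C : ℝ} (hW : ∀ n k, Measurable[ℱ n (k - h)] (W n k))
    (hC : ∀ n k x, |W n k x| ≤ C) :
    ∀ᵐ x ∂μ, Tendsto (fun n : ℕ => (n : ℝ)⁻¹ *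
      ∑ k ∈ Finset.range n, W n k x * Z n (k + 1 - h) x) atTop (𝓝 0) :=
  ae_tendsto_average_of_isMartingaleDiff
    fun n => hZ.isMartingaleDiff_mul h n (hW n) (hC n)

lemma ae_tendsto_average_sq (hZ : IsCenteredBinaryArray μ ℱ Z v q) {ν : ℝ}
    (hν : Tendsto (fun n : ℕ => (n : ℝ)⁻¹ * ∑ k ∈ Finset.range n, v n (k + 1)) atTop (𝓝 ν)) :
    ∀ᵐ x ∂μ, Tendsto (fun n : ℕ => (n : ℝ)⁻¹ *
      ∑ k ∈ Finset.range n, Z n (k + 1) x ^ 2) atTop (𝓝 ν) := by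
  filter_upwards [hZ.ae_tendsto_average_mul 0 (W := fun n k _ => q n (k + 1)) (C := 1)
    (fun _ _ => measurable_const) (fun n k _ => hZ.abs_q_le n (k + 1))] with x hx
  have := hν.add hx
  rw [add_zero] at this
  refine this.congr fun n => ?_
  rw [← mul_add, ← Finset.sum_add_distrib]
  simp [hZ.sq]

/-- The more recent variable `Z n (k - i)` is the innovation, at delay `i + 1`; the older one
belongs to the weight. -/
lemma ae_tendsto_average_offDiag (hZ : IsCenteredBinaryArray μ ℱ Z v q) {i j : ℕ} (hij : i < j) :
    ∀ᵐ x ∂μ, Tendsto (fun n : ℕ => (n : ℝ)⁻¹ *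
      ∑ k ∈ Finset.range n, v n (k + 1) * (Z n (k - i) x * Z n (k - j) x)) atTop (𝓝 0) := by
  filter_upwards [hZ.ae_tendsto_average_mul (i + 1)
    (W := fun n k x => v n (k + 1) * Z n (k - j) x) (C := 1)
    (fun n k => (hZ.measurable_of_le n (by omega)).const_mul _) (fun n k x => by
      rw [abs_mul]
      exact mul_le_one₀ (hZ.abs_v_le n _) (abs_nonneg _) (hZ.bound n _ x))] with x hx
  refine hx.congr fun n => ?_
  congr 1
  refine Finset.sum_congr rfl fun k _ => ?_
  rw [Nat.add_sub_add_right]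
  ring

lemma ae_tendsto_average_diag (hZ : IsCenteredBinaryArray μ ℱ Z v q) (i : ℕ) :
    ∀ᵐ x ∂μ, Tendsto (fun n : ℕ => (n : ℝ)⁻¹ *
      ∑ k ∈ Finset.range n, v n (k + 1) * (q n (k - i) * Z n (k - i) x)) atTop (𝓝 0) := by
  filter_upwards [hZ.ae_tendsto_average_mul (i + 1)
    (W := fun n k x => v n (k + 1) * q n (k - i)) (C := 1)
    (fun n k => measurable_const) (fun n k x => by
      rw [abs_mul]
      exact mul_le_one₀ (hZ.abs_v_le n _) (abs_nonneg _) (hZ.abs_q_le n _))] with x hx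
  refine hx.congr fun n => ?_
  congr 1
  refine Finset.sum_congr rfl fun k _ => ?_
  rw [Nat.add_sub_add_right]
  ring

/-- The covariation of two lags, weighted by the conditional variance. -/
lemma ae_tendsto_average_lag_mul_lag (hZ : IsCenteredBinaryArray μ ℱ Z v q) {κ : ℝ}
    (hκ : ∀ h, Tendsto (fun n : ℕ => (n : ℝ)⁻¹ *
      ∑ k ∈ Finset.range n, v n (k + 1) * v n (k + 1 - h)) atTop (𝓝 κ)) (i j : ℕ) :
    ∀ᵐ x ∂μ, Tendsto (fun n : ℕ => (n : ℝ)⁻¹ *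
      ∑ k ∈ Finset.range n, v n (k + 1) * (Z n (k - i) x * Z n (k - j) x)) atTop
      (𝓝 (if i = j then κ else 0)) := by
  rcases lt_trichotomy i j with h | rfl | h
  · simpa [h.ne] using hZ.ae_tendsto_average_offDiag h
  · filter_upwards [hZ.ae_tendsto_average_diag i] with x hx
    have := (hκ (i + 1)).add hx
    rw [add_zero] at this
    rw [if_pos rfl]
    refine this.congr fun n => ?_
    rw [← mul_add, ← Finset.sum_add_distrib]
    congr 1
    refine Finset.sum_congr rfl fun k _ => ?_
    rw [Nat.add_sub_add_right, ← mul_add, ← hZ.sq, pow_two]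
  · simpa [h.ne', mul_comm] using hZ.ae_tendsto_average_offDiag h

variable {m : ℕ}

/-- The linear combinations of lagged products required by the Cramér–Wold device. -/
lemma isMartingaleDiff_lags (hZ : IsCenteredBinaryArray μ ℱ Z v q) (c : Fin m → ℝ) (n : ℕ) :
    IsMartingaleDiff μ (delay (ℱ n) 0)
      (fun k x => (∑ i : Fin m, c i * Z n (k - i) x) * Z n (k + 1) x) (∑ i, |c i|) := by
  refine hZ.isMartingaleDiff_mul 0 n (W := fun k x => ∑ i : Fin m, c i * Z n (k - i) x)
    (fun k => ?_) fun k x => ?_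
  · exact Finset.measurable_sum _ fun i _ => (hZ.measurable_of_le n (by omega)).const_mul _
  · refine (Finset.abs_sum_le_sum_abs _ _).trans (Finset.sum_le_sum fun i _ => ?_)
    rw [abs_mul]
    exact mul_le_of_le_one_right (abs_nonneg _) (hZ.bound n _ x)

/-- With `L` the combination of lags, `L² Z² = v L² + q L² Z`. The last term is a martingale
difference; expanding `v L²` over pairs of lags leaves only the diagonal in the limit, each pair
contributing `κ`. -/
lemma ae_tendsto_average_lags_sq (hZ : IsCenteredBinaryArray μ ℱ Z v q) {κ : ℝ}
    (hκ : ∀ h, Tendsto (fun n : ℕ => (n : ℝ)⁻¹ *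
      ∑ k ∈ Finset.range n, v n (k + 1) * v n (k + 1 - h)) atTop (𝓝 κ)) (c : Fin m → ℝ) :
    ∀ᵐ x ∂μ, Tendsto (fun n : ℕ => (n : ℝ)⁻¹ * ∑ k ∈ Finset.range n,
      ((∑ i : Fin m, c i * Z n (k - i) x) * Z n (k + 1) x) ^ 2) atTop
      (𝓝 ((∑ i, c i ^ 2) * κ)) := by
  set L : ℕ → ℕ → Ω → ℝ := fun n k x => ∑ i : Fin m, c i * Z n (k - i) x with hL
  have hLm : ∀ n k, Measurable[ℱ n (k - 0)] (L n k) := fun n k =>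
    Finset.measurable_sum _ fun i _ => (hZ.measurable_of_le n (by omega)).const_mul _
  have hLb : ∀ n k x, |L n k x| ≤ ∑ i, |c i| := fun n k x => by
    refine (Finset.abs_sum_le_sum_abs _ _).trans (Finset.sum_le_sum fun i _ => ?_)
    rw [abs_mul]
    exact mul_le_of_le_one_right (abs_nonneg _) (hZ.bound n _ x)
  have h1 := hZ.ae_tendsto_average_mul 0 (W := fun n k x => q n (k + 1) * L n k x ^ 2)
    (C := (∑ i, |c i|) ^ 2) (fun n k => ((hLm n k).pow_const 2).const_mul _) (fun n k x => by
      rw [abs_mul, abs_pow]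
      calc _ ≤ 1 * (∑ i, |c i|) ^ 2 := mul_le_mul (hZ.abs_q_le n _)
            (pow_le_pow_left₀ (abs_nonneg _) (hLb n k x) 2) (by positivity) zero_le_one
        _ = _ := one_mul _)
  have h2 := ae_all_iff.2 fun i : Fin m => ae_all_iff.2 fun j : Fin m =>
    hZ.ae_tendsto_average_lag_mul_lag hκ i j
  filter_upwards [h1, h2] with x hx1 hx2
  have h3 := hx1.add (tendsto_finsetSum Finset.univ fun i _ =>
    tendsto_finsetSum Finset.univ fun j _ => (hx2 i j).const_mul (c i * c j))
  have e : (0 : ℝ) + ∑ i : Fin m, ∑ j : Fin m, c i * c j * (if (i : ℕ) = j then κ else 0) =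
      (∑ i, c i ^ 2) * κ := by
    simp [Fin.val_inj, Finset.sum_mul, pow_two]
  rw [e] at h3
  refine h3.congr fun n => ?_
  have e1 : ∀ k, (L n k x * Z n (k + 1) x) ^ 2 = q n (k + 1) * L n k x ^ 2 * Z n (k + 1) x +
      ∑ i : Fin m, ∑ j : Fin m,
        c i * c j * (v n (k + 1) * (Z n (k - i) x * Z n (k - j) x)) := by
    intro k
    have : ∑ i : Fin m, ∑ j : Fin m,
        c i * c j * (v n (k + 1) * (Z n (k - i) x * Z n (k - j) x)) =
        v n (k + 1) * L n k x ^ 2 := by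
      rw [pow_two, hL]
      simp only
      rw [Finset.sum_mul_sum, Finset.mul_sum]
      refine Finset.sum_congr rfl fun i _ => ?_
      rw [Finset.mul_sum]
      exact Finset.sum_congr rfl fun j _ => by ring
    rw [this, mul_pow, hZ.sq]
    ring
  change _ = (n : ℝ)⁻¹ * ∑ k ∈ Finset.range n, (L n k x * Z n (k + 1) x) ^ 2
  simp_rw [e1]
  rw [Finset.sum_add_distrib, mul_add]
  congr 1
  simp only [Finset.mul_sum]
  symm
  rw [Finset.sum_comm]
  refine Finset.sum_congr rfl fun i _ => ?_
  rw [Finset.sum_comm]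
  refine Finset.sum_congr rfl fun j _ => Finset.sum_congr rfl fun k _ => ?_
  ring

end IsCenteredBinaryArray

end TradeTest

/-! ### The observations as a centered binary array. -/

namespace TradeTest

section TradeArray

variable {Ω : Type*} [mΩ : MeasurableSpace Ω] {μ : Measure Ω}

/-- The filtration generated by the observations in the sample of size `n`. -/
def observedUpTo (a : ℕ → ℕ → Ω → ℝ) (ha : ∀ n, ∀ t ∈ Finset.Icc 1 n, Measurable (a n t))
    (n : ℕ) : Filtration ℕ mΩ where
  seq t := ⨆ s ∈ {s : Finset.Icc 1 n | (s : ℕ) ≤ t},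
    MeasurableSpace.comap (a n s) inferInstance
  mono' _ _ hij := biSup_mono fun _ hs => le_trans hs hij
  le' _ := iSup₂_le fun s _ => (ha n s s.2).comap_le

/-- The centered observations, extended by `0` outside the sample. -/
noncomputable def centeredExt (μ : Measure Ω) (a : ℕ → ℕ → Ω → ℝ) (n t : ℕ) (x : Ω) : ℝ :=
  if t ∈ Finset.Icc 1 n then centered μ a n t x else 0

/-- The values of `f` at the points `t / n` of `(0,1]`, extended by `0`. -/
noncomputable def gridValue (f : ℝ → ℝ) (n t : ℕ) : ℝ :=
  if t ∈ Finset.Icc 1 n then f ((t : ℝ) / n) else 0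

lemma centeredExt_of_mem {a : ℕ → ℕ → Ω → ℝ} {n t : ℕ} (ht : t ∈ Finset.Icc 1 n) (x : Ω) :
    centeredExt μ a n t x = centered μ a n t x := if_pos ht

lemma gridValue_of_mem {f : ℝ → ℝ} {n t : ℕ} (ht : t ∈ Finset.Icc 1 n) :
    gridValue f n t = f ((t : ℝ) / n) := if_pos ht

lemma div_mem_Ioc {n t : ℕ} (ht : t ∈ Finset.Icc 1 n) : (t : ℝ) / n ∈ Set.Ioc (0 : ℝ) 1 := by
  obtain ⟨h1, h2⟩ := Finset.mem_Icc.1 ht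
  have ht' : (0 : ℝ) < t := by exact_mod_cast h1
  have hn' : (t : ℝ) ≤ n := by exact_mod_cast h2
  have hn0 : (0 : ℝ) < n := ht'.trans_le hn'
  exact ⟨by positivity, (div_le_one hn0).2 hn'⟩

lemma abs_gridValue_le {f : ℝ → ℝ} {B : ℝ} (hB : 0 ≤ B)
    (hf : ∀ u ∈ Set.Ioc (0 : ℝ) 1, |f u| ≤ B) (n t : ℕ) : |gridValue f n t| ≤ B := by
  unfold gridValue
  split_ifs with ht
  · exact hf _ (div_mem_Ioc ht)
  · simpa using hB

/-- Independence within the row separates `a n (t + 1)` from the σ-algebra of earlier dates, so its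
conditional mean is its mean. The identity for squares is checked at the two values `0` and `1`. -/
lemma isCenteredBinaryArray_centeredExt [IsProbabilityMeasure μ] {g : ℝ → ℝ}
    (hg01 : ∀ u ∈ Set.Ioc (0 : ℝ) 1, 0 < g u ∧ g u < 1) {a : ℕ → ℕ → Ω → ℝ}
    (ha_meas : ∀ n, ∀ t ∈ Finset.Icc 1 n, Measurable (a n t))
    (ha_bin : ∀ n, ∀ t ∈ Finset.Icc 1 n, ∀ x, a n t x = 0 ∨ a n t x = 1)
    (ha_prob : ∀ n, ∀ t ∈ Finset.Icc 1 n, μ.real {x | a n t x = 1} = g ((t : ℝ) / n))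
    (ha_indep : ∀ n, iIndepFun (fun t : Finset.Icc 1 n => a n t) μ) :
    IsCenteredBinaryArray μ (observedUpTo a ha_meas) (centeredExt μ a)
      (gridValue fun u => g u * (1 - g u)) (gridValue fun u => 1 - 2 * g u) where
  measurable n t := by
    by_cases ht : t ∈ Finset.Icc 1 n
    · have h1 : Measurable[observedUpTo a ha_meas n t] (a n t) := by
        refine Measurable.mono (comap_measurable (a n t)) ?_ le_rfl
        exact le_iSup₂_of_le (⟨t, ht⟩ : Finset.Icc 1 n) (le_refl t) le_rfl
      have h2 : centeredExt μ a n t = fun x => a n t x - tradeProb μ a n t :=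
        funext fun x => centeredExt_of_mem ht x
      rw [h2]
      exact h1.sub_const _
    · have h2 : centeredExt μ a n t = fun _ => 0 := funext fun x => if_neg ht
      rw [h2]
      exact measurable_const
  zero n x := by simp [centeredExt]
  bound n t x := by
    by_cases ht : t ∈ Finset.Icc 1 n
    · rw [centeredExt_of_mem ht, centered, tradeProb, ha_prob n t ht]
      obtain ⟨h0, h1⟩ := hg01 _ (div_mem_Ioc ht)
      rcases ha_bin n t ht x with h | h <;> rw [h, abs_le] <;> constructor <;> linarith
    · simp [centeredExt, ht]
  condExp n t := by
    by_cases ht : t + 1 ∈ Finset.Icc 1 n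
    · have h2 : centeredExt μ a n (t + 1) = fun x => a n (t + 1) x - tradeProb μ a n (t + 1) :=
        funext fun x => centeredExt_of_mem ht x
      have hmean : ∫ x, centeredExt μ a n (t + 1) x ∂μ = 0 := by
        have hset : MeasurableSet {x | a n (t + 1) x = 1} :=
          ha_meas n _ ht (measurableSet_singleton 1)
        have hind : a n (t + 1) = {x | a n (t + 1) x = 1}.indicator 1 := by
          funext x
          by_cases hx : a n (t + 1) x = 1
          · simp [hx]
          · simp [(ha_bin n _ ht x).resolve_right hx]
        have hint : ∫ x, a n (t + 1) x ∂μ = tradeProb μ a n (t + 1) := by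
          conv_lhs => rw [hind]
          rw [integral_indicator_one hset]; rfl
        have hai : Integrable (a n (t + 1)) μ :=
          Integrable.of_bound (ha_meas n _ ht).aestronglyMeasurable 1 (ae_of_all _ fun x => by
            rcases ha_bin n _ ht x with h | h <;> simp [h])
        rw [h2, integral_sub hai (integrable_const _), hint]
        simp
      set τ : Finset.Icc 1 n := ⟨t + 1, ht⟩ with hτ
      have hind := indep_iSup_of_disjoint
        (m := fun s : Finset.Icc 1 n => MeasurableSpace.comap (a n s) inferInstance)
        (fun s => (ha_meas n s s.2).comap_le) (ha_indep n) (S := {τ})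
        (T := {s : Finset.Icc 1 n | (s : ℕ) ≤ t}) (by
          rw [Set.disjoint_singleton_left]
          simp [hτ])
      have hle : (⨆ s ∈ ({τ} : Set (Finset.Icc 1 n)),
          MeasurableSpace.comap (a n s) inferInstance) ≤ mΩ :=
        iSup₂_le fun s _ => (ha_meas n s s.2).comap_le
      have hm : Measurable[⨆ s ∈ ({τ} : Set (Finset.Icc 1 n)),
          MeasurableSpace.comap (a n s) inferInstance] (centeredExt μ a n (t + 1)) := by
        have h1 : Measurable[⨆ s ∈ ({τ} : Set (Finset.Icc 1 n)),
            MeasurableSpace.comap (a n s) inferInstance] (a n (t + 1)) :=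
          Measurable.mono (comap_measurable (a n (t + 1)))
            (le_iSup₂_of_le τ (Set.mem_singleton τ) le_rfl) le_rfl
        rw [h2]
        exact h1.sub_const _
      have := condExp_indep_eq hle ((observedUpTo a ha_meas n).le t) hm.stronglyMeasurable hind
      rw [hmean] at this
      exact this
    · have h2 : centeredExt μ a n (t + 1) = 0 := funext fun x => if_neg ht
      rw [h2, condExp_zero]
  sq n t x := by
    by_cases ht : t ∈ Finset.Icc 1 n
    · rw [centeredExt_of_mem ht, gridValue_of_mem ht, gridValue_of_mem ht, centered, tradeProb,
        ha_prob n t ht]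
      rcases ha_bin n t ht x with h | h <;> rw [h] <;> ring
    · simp [centeredExt, gridValue, ht]
  abs_v_le := abs_gridValue_le zero_le_one fun u hu => by
    obtain ⟨h0, h1⟩ := hg01 u hu
    rw [abs_le]; constructor <;> nlinarith
  abs_q_le := abs_gridValue_le zero_le_one fun u hu => by
    obtain ⟨h0, h1⟩ := hg01 u hu
    rw [abs_le]; constructor <;> linarith

/-- For `s` in the open interval the shifted index eventually lies in the sample, so the extension
by `0` plays no role. -/
lemma tendsto_gridValue {f : ℝ → ℝ} {s : ℝ} (hs : s ∈ Set.Ioo (0 : ℝ) 1)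
    (hf : ContinuousAt f s) (h : ℕ) :
    Tendsto (fun n : ℕ => gridValue f n (⌈(n : ℝ) * s⌉₊ - h)) atTop (𝓝 (f s)) := by
  have h1 := tendsto_natCeil_mul_sub_div hs.1.le h
  have h2 : Tendsto (fun n : ℕ => f (((⌈(n : ℝ) * s⌉₊ - h : ℕ) : ℝ) / n)) atTop (𝓝 (f s)) :=
    hf.tendsto.comp h1
  refine h2.congr' ?_
  filter_upwards [h1.eventually (Ioo_mem_nhds hs.1 hs.2), eventually_gt_atTop 0] with n hn hn0
  have hn' : (0 : ℝ) < n := by exact_mod_cast hn0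
  refine (gridValue_of_mem (Finset.mem_Icc.2 ⟨?_, ?_⟩)).symm
  · rw [Nat.one_le_iff_ne_zero]
    intro h0
    rw [h0] at hn
    simp at hn
  · exact_mod_cast ((div_lt_one hn').1 hn.2).le

lemma ae_mem_Ioo : ∀ᵐ s ∂(volume.restrict (Set.Ioc (0 : ℝ) 1)), s ∈ Set.Ioo (0 : ℝ) 1 := by
  rw [← Measure.restrict_congr_set (Ioo_ae_eq_Ioc (μ := volume) (a := (0 : ℝ)) (b := 1))]
  exact ae_restrict_mem measurableSet_Ioo

variable {f : ℝ → ℝ}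

lemma tendsto_average_gridValue
    (hc : ∀ᵐ s ∂(volume.restrict (Set.Ioc (0 : ℝ) 1)), ContinuousAt f s)
    (hb : ∀ u ∈ Set.Ioc (0 : ℝ) 1, |f u| ≤ 1) :
    Tendsto (fun n : ℕ => (n : ℝ)⁻¹ * ∑ k ∈ Finset.range n, gridValue f n (k + 1)) atTop
      (𝓝 (∫ s in (0 : ℝ)..1, f s)) := by
  refine tendsto_average_of_tendsto_natCeil (abs_gridValue_le zero_le_one hb) ?_
  filter_upwards [hc, ae_mem_Ioo] with s hs hs1
  exact tendsto_gridValue hs1 hs 0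

lemma tendsto_average_gridValue_mul
    (hc : ∀ᵐ s ∂(volume.restrict (Set.Ioc (0 : ℝ) 1)), ContinuousAt f s)
    (hb : ∀ u ∈ Set.Ioc (0 : ℝ) 1, |f u| ≤ 1) (h : ℕ) :
    Tendsto (fun n : ℕ => (n : ℝ)⁻¹ *
      ∑ k ∈ Finset.range n, gridValue f n (k + 1) * gridValue f n (k + 1 - h)) atTop
      (𝓝 (∫ s in (0 : ℝ)..1, f s ^ 2)) := by
  refine tendsto_average_of_tendsto_natCeil
    (u := fun n t => gridValue f n t * gridValue f n (t - h)) (B := 1) (fun n t => ?_) ?_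
  · rw [abs_mul]
    exact mul_le_one₀ (abs_gridValue_le zero_le_one hb n t) (abs_nonneg _)
      (abs_gridValue_le zero_le_one hb n _)
  · filter_upwards [hc, ae_mem_Ioo] with s hs hs1
    rw [pow_two]
    exact (tendsto_gridValue hs1 hs 0).mul (tendsto_gridValue hs1 hs h)

lemma integral_pos_of_ae_continuousAt
    (hc : ∀ᵐ s ∂(volume.restrict (Set.Ioc (0 : ℝ) 1)), ContinuousAt f s)
    (hb : ∀ u ∈ Set.Ioc (0 : ℝ) 1, |f u| ≤ 1) (hpos : ∀ u ∈ Set.Ioc (0 : ℝ) 1, 0 < f u) :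
    0 < ∫ s in (0 : ℝ)..1, f s := by
  -- Measurability of `f` is not assumed; it follows from almost everywhere convergence of the grid
  -- step functions.
  have hm : AEStronglyMeasurable f (volume.restrict (Set.Ioc (0 : ℝ) 1)) := by
    refine aestronglyMeasurable_of_tendsto_ae atTop
      (f := fun (n : ℕ) (s : ℝ) => gridValue f n ⌈(n : ℝ) * s⌉₊)
      (fun n => ((measurable_from_nat (f := gridValue f n)).comp
        (Nat.measurable_ceil.comp (measurable_const_mul (n : ℝ)))).aestronglyMeasurable) ?_
    filter_upwards [hc, ae_mem_Ioo] with s hs hs1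
    exact tendsto_gridValue hs1 hs 0
  have hi : IntervalIntegrable f volume 0 1 := by
    rw [intervalIntegrable_iff_integrableOn_Ioc_of_le zero_le_one]
    refine Integrable.of_bound hm 1 ?_
    filter_upwards [ae_restrict_mem measurableSet_Ioc] with s hs using hb s hs
  exact intervalIntegral.intervalIntegral_pos_of_pos_on hi
    (fun s hs => hpos s ⟨hs.1, hs.2.le⟩) zero_lt_one

end TradeArray

end TradeTest

/-! ### The statistics as averages, and the limit laws. -/

namespace TradeTest

section Statistics

variable {Ω : Type*} [mΩ : MeasurableSpace Ω] {μ : Measure Ω} {a : ℕ → ℕ → Ω → ℝ}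

/-- The additional terms `t ≤ h` involve date `0` and vanish. `F` is the identity for the
autocovariances and the square for `omegaHat`. -/
lemma sum_lagged_eq {F : ℝ → ℝ} (hF : F 0 = 0) (n h : ℕ) (x : Ω) :
    ∑ t ∈ Finset.Icc (1 + h) n, F (centered μ a n t x * centered μ a n (t - h) x) =
      ∑ k ∈ Finset.range n,
        F (centeredExt μ a n (k + 1) x * centeredExt μ a n (k + 1 - h) x) := by
  have h1 : ∑ k ∈ Finset.range n,
        F (centeredExt μ a n (k + 1) x * centeredExt μ a n (k + 1 - h) x) =
      ∑ t ∈ Finset.Icc 1 n, F (centeredExt μ a n t x * centeredExt μ a n (t - h) x) := by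
    rw [Finset.range_eq_Ico, Finset.sum_Ico_add'
      (fun t => F (centeredExt μ a n t x * centeredExt μ a n (t - h) x)) 0 n 1]
    rfl
  rw [h1, ← Finset.sum_subset (s₁ := Finset.Icc (1 + h) n)
    (Finset.Icc_subset_Icc_left (Nat.le_add_right 1 h))]
  · refine Finset.sum_congr rfl fun t ht => ?_
    rw [Finset.mem_Icc] at ht
    rw [centeredExt_of_mem (Finset.mem_Icc.2 (by omega)),
      centeredExt_of_mem (Finset.mem_Icc.2 (by omega))]
  · intro t ht ht'
    rw [Finset.mem_Icc] at ht ht'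
    have h0 : t - h = 0 := by omega
    rw [h0]
    simp [centeredExt, hF]

lemma gammaTilde_eq (n h : ℕ) (x : Ω) :
    gammaTilde μ a n h x = ((n : ℝ) - h)⁻¹ * ∑ k ∈ Finset.range n,
      centeredExt μ a n (k + 1) x * centeredExt μ a n (k + 1 - h) x := by
  rw [gammaTilde]
  exact congrArg _ (sum_lagged_eq (F := id) rfl n h x)

lemma gammaTilde_zero_eq (n : ℕ) (x : Ω) :
    gammaTilde μ a n 0 x =
      (n : ℝ)⁻¹ * ∑ k ∈ Finset.range n, centeredExt μ a n (k + 1) x ^ 2 := by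
  simp [gammaTilde_eq, pow_two]

lemma omegaHat_eq (n : ℕ) (x : Ω) :
    omegaHat μ a n x = ((n : ℝ)⁻¹ * ∑ k ∈ Finset.range n,
      (centeredExt μ a n (k + 1) x * centeredExt μ a n k x) ^ 2) / gammaTilde μ a n 0 x ^ 2 := by
  have h0 : gammaTilde μ a n 0 x =
      (n : ℝ)⁻¹ * ∑ t ∈ Finset.Icc 1 n, centered μ a n t x ^ 2 := by
    simp [gammaTilde, pow_two]
  rw [omegaHat, h0]
  simp_rw [← mul_pow]
  rw [sum_lagged_eq (F := fun r => r ^ 2) (by simp) n 1 x]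
  rfl

end Statistics

section Limits

variable {m : ℕ}

lemma posSemidef_diagonal_const {w : ℝ} (hw : 0 ≤ w) :
    (Matrix.diagonal fun _ : Fin m => w).PosSemidef :=
  Matrix.PosSemidef.diagonal fun _ => hw

lemma charFun_multivariateGaussian_diagonal {w : ℝ} (hw : 0 ≤ w) (c : EuclideanSpace ℝ (Fin m)) :
    charFun (multivariateGaussian (0 : EuclideanSpace ℝ (Fin m)) (Matrix.diagonal fun _ => w)) c =
      Complex.exp (-((w * ∑ i, c i ^ 2) / 2 : ℝ)) := by
  rw [charFun_multivariateGaussian (posSemidef_diagonal_const hw)]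
  congr 1
  have : c.ofLp ⬝ᵥ (Matrix.diagonal fun _ : Fin m => w).mulVec c.ofLp = w * ∑ i, c i ^ 2 := by
    simp only [dotProduct, Matrix.mulVec_diagonal, Finset.mul_sum]
    exact Finset.sum_congr rfl fun i _ => by ring
  rw [this, inner_zero_right]
  push_cast
  ring

lemma multivariateGaussian_diagonal_eq_map {w : ℝ} (hw : 0 ≤ w) :
    multivariateGaussian (0 : EuclideanSpace ℝ (Fin m)) (Matrix.diagonal fun _ => w) =
      (stdGaussian (EuclideanSpace ℝ (Fin m))).map fun y => √w • y := by
  apply Measure.ext_of_charFun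
  funext c
  rw [charFun_multivariateGaussian_diagonal hw, charFun_map_smul, charFun_stdGaussian, norm_smul,
    ← Complex.ofReal_pow, mul_pow, Real.norm_eq_abs, sq_abs, Real.sq_sqrt hw, EuclideanSpace.real_norm_sq_eq]
  push_cast
  ring_nf

/-- The Gaussian vector is `√w` times a standard one, and the factor `w` cancels from the sum of
squares. -/
lemma map_multivariateGaussian_diagonal_eq_chiSquared {w : ℝ} (hw : 0 < w) :
    (multivariateGaussian (0 : EuclideanSpace ℝ (Fin m)) (Matrix.diagonal fun _ => w)).map
      (fun z => w⁻¹ * ∑ i, z i ^ 2) = chiSquared m := by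
  rw [multivariateGaussian_diagonal_eq_map hw.le, ← map_pi_eq_stdGaussian,
    Measure.map_map (by fun_prop) (by fun_prop), Measure.map_map (by fun_prop) (by fun_prop),
    chiSquared]
  congr 1
  funext y
  simp only [Function.comp_apply, PiLp.smul_apply, smul_eq_mul, mul_pow, Real.sq_sqrt hw.le]
  rw [← Finset.mul_sum, inv_mul_cancel_left₀ hw.ne']

lemma TendstoInDistribution.of_map_eq {ι E Ω' : Type*} {Ω : ι → Type*}
    {mΩ : ∀ i, MeasurableSpace (Ω i)} {μ : ∀ i, Measure (Ω i)} [∀ i, IsProbabilityMeasure (μ i)]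
    {mΩ' : MeasurableSpace Ω'} {μ' : Measure Ω'} [IsProbabilityMeasure μ'] [MeasurableSpace E]
    [TopologicalSpace E] [OpensMeasurableSpace E] {X : ∀ i, Ω i → E} {Z : Ω' → E} {l : Filter ι}
    {ν : Measure E} [IsProbabilityMeasure ν] (h : TendstoInDistribution X l Z μ μ')
    (hν : μ'.map Z = ν) : TendstoInDistribution X l id μ ν where
  forall_aemeasurable := h.forall_aemeasurable
  aemeasurable_limit := aemeasurable_id
  tendsto := by
    have h' := h.tendsto
    simp only [hν] at h'
    simpa only [Measure.map_id] using h'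

end Limits

section Main

variable {Ω : Type*} [mΩ : MeasurableSpace Ω] {μ : Measure Ω} [IsProbabilityMeasure μ] {m : ℕ}

/-- Joint central limit theorem for the sums of lagged products, normalized by `ν`. -/
theorem IsCenteredBinaryArray.tendstoInDistribution_lags {ℱ : ℕ → Filtration ℕ mΩ}
    {Z : ℕ → ℕ → Ω → ℝ} {v q : ℕ → ℕ → ℝ} (hZ : IsCenteredBinaryArray μ ℱ Z v q) {κ ν : ℝ}
    (hκ0 : 0 ≤ κ)
    (hκ : ∀ h, Tendsto (fun n : ℕ => (n : ℝ)⁻¹ *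
      ∑ k ∈ Finset.range n, v n (k + 1) * v n (k + 1 - h)) atTop (𝓝 κ)) :
    TendstoInDistribution (fun (n : ℕ) (x : Ω) => (WithLp.toLp 2 fun i : Fin m =>
        ν⁻¹ * ((√(n : ℝ))⁻¹ * ∑ k ∈ Finset.range n, Z n (k + 1) x * Z n (k - i) x) :
          EuclideanSpace ℝ (Fin m))) atTop id (fun _ => μ)
      (multivariateGaussian (0 : EuclideanSpace ℝ (Fin m))
        (Matrix.diagonal fun _ => κ / ν ^ 2)) := by
  have hmeas : ∀ n : ℕ, Measurable fun x : Ω => (WithLp.toLp 2 fun i : Fin m =>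
        ν⁻¹ * ((√(n : ℝ))⁻¹ * ∑ k ∈ Finset.range n, Z n (k + 1) x * Z n (k - i) x) :
          EuclideanSpace ℝ (Fin m)) := by
    intro n
    refine (WithLp.measurable_toLp 2 _).comp (measurable_pi_lambda _ fun i => ?_)
    exact ((Finset.measurable_sum _ fun k _ =>
      (hZ.measurable' n _).mul (hZ.measurable' n _)).const_mul _).const_mul _
  refine ⟨fun n => (hmeas n).aemeasurable, aemeasurable_id, ?_⟩
  refine ProbabilityMeasure.tendsto_iff_tendsto_charFun.2 fun c => ?_
  -- Cramér–Wold with weights `c i / ν`: the characteristic function at `c` is that of a scalar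
  -- martingale sum at `1`.
  have h := tendsto_integral_exp_of_isMartingaleDiff
    (fun n => hZ.isMartingaleDiff_lags (fun i : Fin m => c i / ν) n)
    (hZ.ae_tendsto_average_lags_sq hκ fun i : Fin m => c i / ν)
  simp only [ProbabilityMeasure.coe_mk, Measure.map_id]
  rw [charFun_multivariateGaussian_diagonal (by positivity)]
  have e : (∑ i, (c i / ν) ^ 2) * κ / 2 = κ / ν ^ 2 * (∑ i, c i ^ 2) / 2 := by
    simp_rw [div_pow]
    rw [← Finset.sum_div]
    ring
  rw [← e]
  refine h.congr fun n => ?_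
  rw [charFun_apply, integral_map (hmeas n).aemeasurable (by fun_prop)]
  refine integral_congr_ae (ae_of_all _ fun x => ?_)
  simp only
  congr 3
  simp only [PiLp.inner_apply, Finset.mul_sum, Finset.sum_mul, RCLike.inner_apply, conj_trivial]
  rw [Finset.sum_comm]
  refine Finset.sum_congr rfl fun i _ => Finset.sum_congr rfl fun k _ => ?_
  ring

end Main

end TradeTest

open TradeTest in
theorem proposition3 {Ω : Type*} [MeasurableSpace Ω] (μ : Measure Ω) [IsProbabilityMeasure μ]
    (g : ℝ → ℝ) (hg01 : ∀ u ∈ Set.Ioc (0 : ℝ) 1, 0 < g u ∧ g u < 1)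
    (hg : TradeTest.PiecewiseLipschitz g)
    (a : ℕ → ℕ → Ω → ℝ)
    (ha_meas : ∀ n, ∀ t ∈ Finset.Icc 1 n, Measurable (a n t))
    (ha_bin : ∀ n, ∀ t ∈ Finset.Icc 1 n, ∀ x, a n t x = 0 ∨ a n t x = 1)
    (ha_prob : ∀ n, ∀ t ∈ Finset.Icc 1 n, μ.real {x | a n t x = 1} = g ((t : ℝ) / n))
    (ha_indep : ∀ n, iIndepFun (fun t : Finset.Icc 1 n => a n t) μ)
    (m : ℕ) (hm : 1 ≤ m) :
    TendstoInDistribution (fun (n : ℕ) (x : Ω) => √(n : ℝ) • TradeTest.Abar μ a m n x) atTop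
        id (fun _ => μ)
        (multivariateGaussian (0 : EuclideanSpace ℝ (Fin m))
          (Matrix.diagonal fun _ => TradeTest.omega g)) ∧
      TendstoInDistribution (fun (n : ℕ) (x : Ω) => TradeTest.Sbar μ a m n x) atTop
        id (fun _ => μ) (TradeTest.chiSquared m) ∧
      ∀ᵐ x ∂μ, Tendsto (fun n : ℕ => TradeTest.omegaHat μ a n x) atTop
        (𝓝 (TradeTest.omega g)) := by
  set f : ℝ → ℝ := fun u => g u * (1 - g u) with hf
  have hfpos : ∀ u ∈ Set.Ioc (0 : ℝ) 1, 0 < f u := fun u hu =>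
    mul_pos (hg01 u hu).1 (sub_pos.2 (hg01 u hu).2)
  have hfb : ∀ u ∈ Set.Ioc (0 : ℝ) 1, |f u| ≤ 1 := fun u hu => by
    rw [abs_of_pos (hfpos u hu)]
    exact mul_le_one₀ (hg01 u hu).2.le (sub_pos.2 (hg01 u hu).2).le (by linarith [(hg01 u hu).1])
  have hfc : ∀ᵐ s ∂(volume.restrict (Set.Ioc (0 : ℝ) 1)), ContinuousAt f s :=
    hg.ae_continuousAt.mono fun s hs => hs.mul (continuousAt_const.sub hs)
  set ν : ℝ := ∫ s in (0 : ℝ)..1, f s with hν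
  set κ : ℝ := ∫ s in (0 : ℝ)..1, f s ^ 2 with hκ
  have hν0 : 0 < ν := integral_pos_of_ae_continuousAt hfc hfb hfpos
  have hκ0 : 0 < κ := integral_pos_of_ae_continuousAt (hfc.mono fun s hs => hs.pow 2)
    (fun u hu => by rw [abs_pow]; exact pow_le_one₀ (abs_nonneg _) (hfb u hu))
    fun u hu => pow_pos (hfpos u hu) 2
  have homega : omega g = κ / ν ^ 2 := by
    simp only [omega, hκ, hν, hf, mul_pow]
  have homega0 : 0 < κ / ν ^ 2 := by positivity
  have hZ := isCenteredBinaryArray_centeredExt hg01 ha_meas ha_bin ha_prob ha_indep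
  have hγ : ∀ᵐ x ∂μ, Tendsto (fun n => gammaTilde μ a n 0 x) atTop (𝓝 ν) := by
    filter_upwards [hZ.ae_tendsto_average_sq (tendsto_average_gridValue hfc hfb)] with x hx
    simpa only [gammaTilde_zero_eq] using hx
  have hω : ∀ᵐ x ∂μ, Tendsto (fun n : ℕ => omegaHat μ a n x) atTop (𝓝 (κ / ν ^ 2)) := by
    -- A single lag with weight one turns the averaged squares into the numerator of `omegaHat`.
    filter_upwards [hγ, hZ.ae_tendsto_average_lags_sq (tendsto_average_gridValue_mul hfc hfb)
      (fun _ : Fin 1 => 1)] with x hx hx'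
    simp only [omegaHat_eq]
    refine Tendsto.div ?_ (hx.pow 2) (by positivity)
    simpa [mul_comm] using hx'
  have hγm : ∀ n h, Measurable (gammaTilde μ a n h) := by
    intro n h
    simp_rw [funext (gammaTilde_eq (μ := μ) (a := a) n h)]
    exact (Finset.measurable_sum _ fun k _ =>
      (hZ.measurable' n _).mul (hZ.measurable' n _)).const_mul _
  have hωm : ∀ n, Measurable (omegaHat μ a n) := by
    intro n
    simp_rw [funext (omegaHat_eq (μ := μ) (a := a) n)]
    exact ((Finset.measurable_sum _ fun k _ =>
      ((hZ.measurable' n _).mul (hZ.measurable' n _)).pow_const 2).const_mul _).div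
        ((hγm n 0).pow_const 2)
  rw [homega]
  have hclt := hZ.tendstoInDistribution_lags (m := m) (ν := ν) hκ0.le
    (tendsto_average_gridValue_mul hfc hfb)
  -- The ratio between the normalization of `Abar` and that of `hclt`. It tends to one almost
  -- surely, and thanks to `0⁻¹ = 0` the resulting identity holds for every `n`, even `n = i + 1`.
  set R : ℕ → Ω → Fin m → ℝ := fun n x i =>
    ν * (n * ((n : ℝ) - ((i + 1 : ℕ) : ℝ))⁻¹) / gammaTilde μ a n 0 x with hR
  have hRm : ∀ n, Measurable (R n) := fun n =>
    measurable_pi_lambda _ fun i => (hγm n 0).const_div _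
  have hRlim : ∀ᵐ x ∂μ, Tendsto (fun n => R n x) atTop (𝓝 1) := by
    filter_upwards [hγ] with x hx
    refine tendsto_pi_nhds.2 fun i => ?_
    have h1 : Tendsto (fun n : ℕ => (n : ℝ) * ((n : ℝ) - ((i + 1 : ℕ) : ℝ))⁻¹) atTop (𝓝 1) := by
      have := tendsto_natCast_div_add_atTop (-((i + 1 : ℕ) : ℝ))
      simpa only [← sub_eq_add_neg, div_eq_mul_inv] using this
    have := (h1.const_mul ν).div hx hν0.ne'
    rw [mul_one, div_self hν0.ne'] at this
    exact this
  have hA : TendstoInDistribution (fun (n : ℕ) (x : Ω) => √(n : ℝ) • Abar μ a m n x) atTop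
      id (fun _ => μ) (multivariateGaussian (0 : EuclideanSpace ℝ (Fin m))
        (Matrix.diagonal fun _ => κ / ν ^ 2)) := by
    have hcont : Continuous fun p : EuclideanSpace ℝ (Fin m) × (Fin m → ℝ) =>
        (WithLp.toLp 2 fun i => p.1 i * p.2 i : EuclideanSpace ℝ (Fin m)) := by fun_prop
    have h := hclt.continuous_comp_prodMk_of_tendstoInMeasure_const hcont (Y := R) (c := 1)
      (tendstoInMeasure_of_tendsto_ae (fun n => (hRm n).aestronglyMeasurable) hRlim)
      (fun n => (hRm n).aemeasurable)
    refine h.congr (fun n => ae_of_all _ fun x => ?_) (ae_of_all _ fun z => ?_)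
    · ext i
      simp only [PiLp.smul_apply, Abar, smul_eq_mul, gammaTilde_eq n ((i : ℕ) + 1),
        Nat.add_sub_add_right, hR]
      rcases Nat.eq_zero_or_pos n with rfl | hn
      · simp
      · have hn' : (0 : ℝ) < n := by exact_mod_cast hn
        have hs : (√(n : ℝ))⁻¹ * n = √(n : ℝ) := by
          rw [inv_mul_eq_div, Real.div_sqrt]
        have hν1 : ν⁻¹ * ν = 1 := inv_mul_cancel₀ hν0.ne'
        generalize ∑ k ∈ Finset.range n,
          centeredExt μ a n (k + 1) x * centeredExt μ a n (k - i) x = S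
        calc _ = (ν⁻¹ * ν) * ((√(n : ℝ))⁻¹ * n) *
              (((n : ℝ) - ((i + 1 : ℕ) : ℝ))⁻¹ * S / gammaTilde μ a n 0 x) := by ring
          _ = _ := by rw [hν1, hs, one_mul]
    · ext i
      simp
  refine ⟨hA, ?_, hω⟩
  -- `Sbar` is this map at `√n • Abar` and `omegaHat⁻¹`, so Slutsky's lemma applies; `κ > 0` makes
  -- the inverse converge.
  have hcont : Continuous fun p : EuclideanSpace ℝ (Fin m) × ℝ => p.2 * ∑ i, p.1 i ^ 2 := by
    fun_prop
  have h := hA.continuous_comp_prodMk_of_tendstoInMeasure_const hcont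
    (Y := fun n x => (omegaHat μ a n x)⁻¹) (c := (κ / ν ^ 2)⁻¹)
    (tendstoInMeasure_of_tendsto_ae (fun n => (hωm n).inv.aestronglyMeasurable)
      (hω.mono fun x hx => hx.inv₀ homega0.ne'))
    (fun n => (hωm n).inv.aemeasurable)
  refine (TendstoInDistribution.of_map_eq h
    (map_multivariateGaussian_diagonal_eq_chiSquared homega0)).congr
    (fun n => ae_of_all _ fun x => ?_) (ae_of_all _ fun _ => rfl)
  simp only [Sbar, PiLp.smul_apply, smul_eq_mul, mul_pow, Real.sq_sqrt (Nat.cast_nonneg n)]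
  rw [← Finset.mul_sum]
  simp_rw [pow_two]
  ring
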